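/- A Lie conformal algebra is a $\mathbb C[\partial]$-module $\mathcal A$ with a $\mathbb C$-bilinear $\lambda$-bracket $\mathcal A\otimes\mathcal A\to\mathcal A[\lambda]$, $a\otimes b\mapsto[a_\lambda b]$, such that $[\partial a_\lambda b]=-\lambda[a_\lambda b]$, $[a_\lambda\partial b]=(\partial+\lambda)[a_\lambda b]$, $[a_\lambda b]=-[b_{-\lambda-\partial}a]$ and $[a_\lambda[b_\mu c]]=[[a_\lambda b]_{\lambda+\mu}c]+[b_\mu[a_\lambda c]]$. An $\mathcal A$-module is a $\mathbb C[\partial]$-module $V$ with a $\mathbb C$-bilinear action $\mathcal A\otimes V\to V[\lambda]$, $a\otimes v\mapsto a_\lambda v$, such that $\partial a_\lambda v=-\lambda(a_\lambda v)$, $a_\lambda\partial v=(\partial+\lambda)a_\lambda v$ and $a_\lambda(b_\mu v)=[a_\lambda b]_{\lambda+\mu}v+b_\mu(a_\lambda v)$; it is finite if it is finitely generated over $\mathbb C[\partial]$. Ideals and submodules are $\mathbb C[\partial]$-submodules stable under all coefficients in $\lambda$ of the bracket, respectively of the action. Let $\operatorname{Tor}V$ be the $\mathbb C[\partial]$-torsion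 submodule of $V$. Let $\mathcal H=\mathbb C[\partial]A\oplus\mathbb C[\partial]B$ be a Lie conformal algebra, free over $\mathbb C[\partial]$ with basis $A,B$, such that $\mathbb C[\partial]A$ and $\mathbb C[\partial]B$ are ideals of $\mathcal H$ (so that $[A_\lambda B]=0$) and $[A_\lambda A]=(\partial+2\lambda)A$. Let $V$ be a finite $\mathcal H$-module on which $A$ acts non-trivially, that is, $A_\lambda v\neq0$ for some $v\in V$. Then: (1) There are a nonzero $u\in V$ and $\alpha,\beta\in\mathbb C$ with $$A_\lambda u=(\partial+\alpha\lambda+\beta)u,\qquad B_\lambda u=0,$$ and $\mathbb C[\partial]u$ is an $\mathcal H$-submodule of $V$. If $\operatorname{Tor}V=0$, then $\mathbb C[\partial]u$ is free of rank one over $\mathbb C[\partial]$. (2) Without any assumption on $\operatorname{Tor}V$, there are $u\in V\setminus\operatorname{Tor}V$ (so that $\mathbb C[\partial]u$ is free of rank one over $\mathbb C[\partial]$) and $\alpha,\beta\in\mathbb C$ such that $B_\lambda u=0$ and $$A_\lambda u\equiv(\partial+\alpha\lambda+\beta)u \pmod{(\operatorname{Tor}V)[\lambda]},$$ and $\mathbb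 C[\partial]u+\operatorname{Tor}V$ is an $\mathcal H$-submodule of $V$. -/

import Mathlib

open Polynomial

noncomputable section

namespace LieConformal

/-! Throughout, `ℂ[∂]` is Mathlib's polynomial ring `ℂ[X]`, so that `∂` acts on a `ℂ[∂]`-module as
the scalar `X`, and `V[λ]` is `PolynomialModule ℂ V`, whose element `p` stands for
`∑ i, p.coeff i * λ ^ i`. -/

/-- The action of `∂` on a `ℂ[∂]`-module, as a `ℂ`-linear map. -/
def del (V : Type*) [AddCommGroup V] [Module ℂ V] [Module ℂ[X] V] [IsScalarTower ℂ ℂ[X] V] :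
    V →ₗ[ℂ] V :=
  Algebra.lsmul ℂ ℂ V (X : ℂ[X])

/-- The action of `∂` on `V[λ]`, coefficient by coefficient. -/
def delPoly (V : Type*) [AddCommGroup V] [Module ℂ V] [Module ℂ[X] V] [IsScalarTower ℂ ℂ[X] V] :
    PolynomialModule ℂ V →ₗ[ℂ] PolynomialModule ℂ V :=
  PolynomialModule.map ℂ (del V)

/-- The constant polynomial `v` in `W[λ]`. -/
def constPoly (W : Type*) [AddCommGroup W] [Module ℂ W] : W →ₗ[ℂ] PolynomialModule ℂ W :=
  PolynomialModule.lsingle ℂ 0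

/-- Multiplication by the variable on `W[λ]`. -/
def mulVar (W : Type*) [AddCommGroup W] [Module ℂ W] :
    PolynomialModule ℂ W →ₗ[ℂ] PolynomialModule ℂ W :=
  Algebra.lsmul ℂ ℂ (PolynomialModule ℂ W) (X : ℂ[X])

/-- Substitution for the variable: the polynomial `∑ i, w i * λ ^ i` is sent to
`∑ i, T ^ i (ι (w i))`. -/
def substVar {W U : Type*} [AddCommGroup W] [Module ℂ W] [AddCommGroup U] [Module ℂ U]
    (T : Module.End ℂ U) (ι : W →ₗ[ℂ] U) (p : PolynomialModule ℂ W) : U :=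
  p.coeff.sum fun i w => (T ^ i) (ι w)

/-! `V[λ, μ]` is `PolynomialModule ℂ (PolynomialModule ℂ V)`: the inner variable is `λ` and the
outer variable is `μ`. -/

/-- Multiplication by `λ` on `V[λ, μ]`. -/
def mulLambda (V : Type*) [AddCommGroup V] [Module ℂ V] :
    Module.End ℂ (PolynomialModule ℂ (PolynomialModule ℂ V)) :=
  PolynomialModule.map ℂ (mulVar V)

/-- Multiplication by `μ` on `V[λ, μ]`. -/
def mulMu (V : Type*) [AddCommGroup V] [Module ℂ V] :
    Module.End ℂ (PolynomialModule ℂ (PolynomialModule ℂ V)) :=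
  mulVar (PolynomialModule ℂ V)

/-- The embedding of `V` into `V[λ, μ]` as constants. -/
def constPoly₂ (V : Type*) [AddCommGroup V] [Module ℂ V] :
    V →ₗ[ℂ] PolynomialModule ℂ (PolynomialModule ℂ V) :=
  constPoly (PolynomialModule ℂ V) ∘ₗ constPoly V

section Composites

variable {A V : Type*} [AddCommGroup A] [Module ℂ A] [AddCommGroup V] [Module ℂ V]

/-- For a family `act` of maps `m ↦ a_λ m`, the expression `a_λ (b_μ m)` in `V[λ, μ]`. -/
def lamMu (act : A →ₗ[ℂ] V →ₗ[ℂ] PolynomialModule ℂ V) (a b : A) (m : V) :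
    PolynomialModule ℂ (PolynomialModule ℂ V) :=
  substVar (mulMu V) (constPoly (PolynomialModule ℂ V) ∘ₗ act a) (act b m)

/-- The expression `b_μ (a_λ m)` in `V[λ, μ]`: here `b_μ v = ∑ i, (coefficient i) * μ ^ i`
is placed into `V[λ, μ]` by regarding its coefficients as constants in `λ`. -/
def muLam (act : A →ₗ[ℂ] V →ₗ[ℂ] PolynomialModule ℂ V) (b a : A) (m : V) :
    PolynomialModule ℂ (PolynomialModule ℂ V) :=
  substVar (mulLambda V) (PolynomialModule.map ℂ (constPoly V) ∘ₗ act b) (act a m)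

/-- The expression `c_{λ+μ} m` in `V[λ, μ]`. -/
def lamAddMu (act : A →ₗ[ℂ] V →ₗ[ℂ] PolynomialModule ℂ V) (m : V) :
    A →ₗ[ℂ] PolynomialModule ℂ (PolynomialModule ℂ V) where
  toFun c := substVar (mulLambda V + mulMu V) (constPoly₂ V) (act c m)
  map_add' c d := by
    simp only [substVar, map_add, LinearMap.add_apply, PolynomialModule.coeff_add]
    exact Finsupp.sum_add_index' (fun _ => by simp) (fun _ _ _ => by simp)
  map_smul' r c := by
    have h : (act (r • c) m).coeff = r • (act c m).coeff := by
      rw [map_smul, LinearMap.smul_apply]; rfl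
    simp only [substVar, h, RingHom.id_apply]
    rw [Finsupp.sum_smul_index' (fun _ => by simp), Finsupp.smul_sum]
    simp only [map_smul]

/-- The expression `(p(λ))_{λ+μ} m` in `V[λ, μ]`, for `p(λ)` in `A[λ]`: if
`p(λ) = ∑ j, c j * λ ^ j`, it is `∑ j, λ ^ j * ((c j)_{λ+μ} m)`. -/
def polyLamAddMu (act : A →ₗ[ℂ] V →ₗ[ℂ] PolynomialModule ℂ V) (p : PolynomialModule ℂ A) (m : V) :
    PolynomialModule ℂ (PolynomialModule ℂ V) :=
  substVar (mulLambda V) (lamAddMu act m) p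

end Composites

/-- A Lie conformal algebra: a `ℂ[∂]`-module with a `λ`-bracket `𝒜 ⊗ 𝒜 → 𝒜[λ]`. -/
class LieConformalAlgebra (𝒜 : Type*) [AddCommGroup 𝒜] [Module ℂ 𝒜] [Module ℂ[X] 𝒜]
    [IsScalarTower ℂ ℂ[X] 𝒜] where
  /-- `bracket a b` is `[a_λ b]`. -/
  bracket : 𝒜 →ₗ[ℂ] 𝒜 →ₗ[ℂ] PolynomialModule ℂ 𝒜
  /-- `[(∂a)_λ b] = -λ [a_λ b]` -/
  del_bracket : ∀ a b : 𝒜, bracket (del 𝒜 a) b = -mulVar 𝒜 (bracket a b)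
  /-- `[a_λ (∂b)] = (∂ + λ) [a_λ b]` -/
  bracket_del : ∀ a b : 𝒜, bracket a (del 𝒜 b) = delPoly 𝒜 (bracket a b) + mulVar 𝒜 (bracket a b)
  /-- `[a_λ b] = -[b_{-λ-∂} a]` -/
  skew : ∀ a b : 𝒜, bracket a b = -substVar (-mulVar 𝒜 - delPoly 𝒜) (constPoly 𝒜) (bracket b a)
  /-- `[a_λ [b_μ c]] = [[a_λ b]_{λ+μ} c] + [b_μ [a_λ c]]` -/
  jacobi : ∀ a b c : 𝒜, lamMu bracket a b c =
    polyLamAddMu bracket (bracket a b) c + muLam bracket b a c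

/-- A conformal module over a Lie conformal algebra `𝒜`: a `ℂ[∂]`-module `V` with a
`λ`-action `𝒜 ⊗ V → V[λ]`. -/
class ConformalModule (𝒜 : Type*) [AddCommGroup 𝒜] [Module ℂ 𝒜] [Module ℂ[X] 𝒜]
    [IsScalarTower ℂ ℂ[X] 𝒜] [LieConformalAlgebra 𝒜]
    (V : Type*) [AddCommGroup V] [Module ℂ V] [Module ℂ[X] V] [IsScalarTower ℂ ℂ[X] V] where
  /-- `act a m` is `a_λ m`. -/
  act : 𝒜 →ₗ[ℂ] V →ₗ[ℂ] PolynomialModule ℂ V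
  /-- `(∂a)_λ m = -λ (a_λ m)` -/
  del_act : ∀ (a : 𝒜) (m : V), act (del 𝒜 a) m = -mulVar V (act a m)
  /-- `a_λ (∂m) = (∂ + λ) (a_λ m)` -/
  act_del : ∀ (a : 𝒜) (m : V), act a (del V m) = delPoly V (act a m) + mulVar V (act a m)
  /-- `a_λ (b_μ m) = [a_λ b]_{λ+μ} m + b_μ (a_λ m)` -/
  jacobi : ∀ (a b : 𝒜) (m : V), lamMu act a b m =
    polyLamAddMu act (LieConformalAlgebra.bracket a b) m + muLam act b a m

section Ideals

variable {𝒜 : Type*} [AddCommGroup 𝒜] [Module ℂ 𝒜] [Module ℂ[X] 𝒜] [IsScalarTower ℂ ℂ[X] 𝒜]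
  [LieConformalAlgebra 𝒜]

/-- The `j`-th product `a_(j) b`, where `[a_λ b] = ∑ j, (a_(j) b) * λ ^ j / j!`. -/
def jthProduct (j : ℕ) (a b : 𝒜) : 𝒜 :=
  (j.factorial : ℂ) • (LieConformalAlgebra.bracket a b).coeff j

/-- A `ℂ[∂]`-submodule that is an ideal of the Lie conformal algebra `𝒜`. -/
def IsIdeal (I : Submodule ℂ[X] 𝒜) : Prop :=
  ∀ (a b : 𝒜), b ∈ I → ∀ j : ℕ, jthProduct j a b ∈ I

variable {V : Type*} [AddCommGroup V] [Module ℂ V] [Module ℂ[X] V] [IsScalarTower ℂ ℂ[X] V]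
  [ConformalModule 𝒜 V]

/-- The `j`-th product `a_(j) m`, where `a_λ m = ∑ j, (a_(j) m) * λ ^ j / j!`. -/
def jthAction (j : ℕ) (a : 𝒜) (m : V) : V :=
  (j.factorial : ℂ) • (ConformalModule.act a m).coeff j

variable (𝒜) in
/-- A `ℂ[∂]`-submodule of `V` that is an `𝒜`-submodule. -/
def IsConformalSubmodule (N : Submodule ℂ[X] V) : Prop :=
  ∀ (a : 𝒜) (m : V), m ∈ N → ∀ j : ℕ, jthAction j a m ∈ N

end Ideals

/-- The polynomial `(∂ + α λ + β) w` in `W[λ]`. -/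
def primary {W : Type*} [AddCommGroup W] [Module ℂ W] [Module ℂ[X] W] [IsScalarTower ℂ ℂ[X] W]
    (α β : ℂ) (w : W) : PolynomialModule ℂ W :=
  constPoly W (del W w) + α • mulVar W (constPoly W w) + β • constPoly W w

end LieConformal

end

open LieConformal

noncomputable section

namespace LieConformal

/-! ### Eigenvectors from annihilating polynomials. -/

section Operators

variable {W : Type*} [AddCommGroup W] [Module ℂ W]

/-! Write `L n` for the coefficient of `λ ^ n / n!` in the action of `A`. The module axioms become
`[L n, ∂] = n L (n - 1)` and `[L m, L n] = (m - n) L (m + n - 1)`. A primary vector is a common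
eigenvector of `∂ - L 0` and `L 1` killed by every `L n` with `n ≥ 2`.

Since `V` may be infinite-dimensional over `ℂ`, eigenvectors must come from finiteness over `ℂ[∂]`.
Any sequence in `V` is `ℂ[∂]`-dependent, and the leading terms in `λ` of `f(∂ + λ) (A_λ w)` turn the
dependence into a scalar relation among the images under the top operator `L M`
(`IsCoeffFamily.exists_top_relation`). Applied to the iterates of `∂ - L 0`, which commutes with
every `L n`, this gives an eigenvalue `c`. Take `M` least such that some nonzero `c`-eigenvector has
`λ`-degree at most `M`. If `M = 0`, that vector is primary. Otherwise `L M` is injective on the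
bounded eigenspace, so the same device yields an eigenvector of `L 1`. If `M > 1`, the powers of `L
M` would move it through infinitely many eigenvalues in contradiction with a scalar relation, so `M
= 1` (`exists_primary_vector`).

Because `[A_λ B] = 0`, comparing `B_λ (L 0 u)` with `B_λ ((∂ + β) u)` forces `B_λ u = 0`
(`IsCoeffFamily.apply_eq_zero_of_comm`). Torsion is killed by every element, so the argument runs in
`V / Tor V` for the second part, and `B_λ u = 0` still holds exactly after lifting. -/

lemma sum_smul_pow_apply (R : Module.End ℂ W) (q : ℂ[X]) (w : W) :
    (q.sum fun i a => a • (R ^ i) w) = aeval R q w := by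
  rw [aeval_eq_sum_range, Polynomial.sum_over_range _ (by simp)]
  simp

lemma pow_apply_mem (R : Module.End ℂ W) (P : Submodule ℂ W) (hP : ∀ w ∈ P, R w ∈ P)
    {w : W} (hw : w ∈ P) (i : ℕ) : (R ^ i) w ∈ P := by
  induction i with
  | zero => simpa using hw
  | succ i ih => rw [pow_succ', Module.End.mul_apply]; exact hP _ ih

/-- A nonzero polynomial in an operator annihilating a nonzero vector of an invariant subspace
yields an eigenvector in that subspace. -/
lemma exists_eigenvector_of_aeval_eq_zero (R : Module.End ℂ W) (P : Submodule ℂ W)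
    (hP : ∀ w ∈ P, R w ∈ P) {q : ℂ[X]} (hq : q ≠ 0) {y : W} (hy : y ∈ P) (hy0 : y ≠ 0)
    (h : aeval R q y = 0) : ∃ (c : ℂ) (u : W), u ∈ P ∧ u ≠ 0 ∧ R u = c • u := by
  induction hd : q.natDegree using Nat.strong_induction_on generalizing q with
  | _ d ih =>
    rcases Nat.eq_zero_or_pos d with h0 | hpos
    · obtain ⟨a, rfl⟩ := natDegree_eq_zero.mp (hd.trans h0)
      rw [aeval_C, Module.algebraMap_end_apply] at h
      rcases smul_eq_zero.mp h with ha | h'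
      · exact absurd (by rw [ha, C_0]) hq
      · exact absurd h' hy0
    · obtain ⟨c, hc⟩ := IsAlgClosed.exists_root q (by
        rw [degree_eq_natDegree hq, hd]; exact_mod_cast hpos.ne')
      obtain ⟨g, rfl⟩ := dvd_iff_isRoot.mpr hc
      have hg : g ≠ 0 := right_ne_zero_of_mul hq
      rw [natDegree_mul (X_sub_C_ne_zero c) hg, natDegree_X_sub_C] at hd
      by_cases hgy : aeval R g y = 0
      · exact ih g.natDegree (by omega) hg hgy rfl
      · refine ⟨c, aeval R g y, ?_, hgy, ?_⟩
        · rw [← sum_smul_pow_apply]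
          exact P.sum_mem fun i _ => P.smul_mem _ (pow_apply_mem R P hP hy i)
        · rw [map_mul, Module.End.mul_apply, map_sub, aeval_X, aeval_C, LinearMap.sub_apply,
            Module.algebraMap_end_apply, sub_eq_zero] at h
          exact h

end Operators

/-! ### Coefficient operators: torsion, scalar relations and primary vectors. -/

section CoefficientFamilies

variable {W : Type*} [AddCommGroup W] [Module ℂ W] [Module ℂ[X] W] [IsScalarTower ℂ ℂ[X] W]

lemma del_apply (w : W) : del W w = (X : ℂ[X]) • w := rfl

/-- A family of operators that behaves like the coefficients `n! * [λ ^ n] (a_λ w)` of the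
action of an element `a` of a Lie conformal algebra. -/
structure IsCoeffFamily (L : ℕ → Module.End ℂ W) : Prop where
  eventually_zero : ∀ w, ∃ M, ∀ n, M < n → L n w = 0
  apply_del : ∀ n w, L n (del W w) = del W (L n w) + (n : ℂ) • L (n - 1) w

/-- The commutation relations of the coefficients of a Virasoro element. -/
def IsVirasoroFamily (L : ℕ → Module.End ℂ W) : Prop :=
  ∀ m n w, L m (L n w) - L n (L m w) = ((m : ℂ) - n) • L (m + n - 1) w

variable {L : ℕ → Module.End ℂ W}

/-- The leading coefficient in `λ` of `a_λ (f(∂) w) = f(∂ + λ) (a_λ w)`. -/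
lemma IsCoeffFamily.apply_smul_top (hL : IsCoeffFamily L) {M : ℕ} (N : ℕ) (f : ℂ[X])
    (hf : f.natDegree ≤ N) {w : W} (hw : ∀ n, M < n → L n w = 0) :
    (∀ n, M + N < n → L n (f • w) = 0) ∧
      (M.factorial : ℂ) • L (M + N) (f • w) =
        ((M + N).factorial : ℂ) • f.coeff N • L M w := by
  induction N generalizing f with
  | zero =>
    obtain ⟨a, rfl⟩ := natDegree_eq_zero.mp (Nat.le_zero.mp hf)
    have hC : (C a : ℂ[X]) • w = a • w := by
      rw [← Polynomial.algebraMap_eq, algebraMap_smul]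
    rw [hC]
    refine ⟨fun n hn => by rw [map_smul, hw n hn, smul_zero], ?_⟩
    simp
  | succ N ih =>
    obtain ⟨ih0, ih1⟩ := ih f.divX (by rw [natDegree_divX_eq_natDegree_tsub_one]; omega)
    -- One factor of `∂` raises the top index by one, and `apply_del` supplies the factor `M + N +
    -- 1` that completes the factorial.
    have hf' : f • w = del W (f.divX • w) + f.coeff 0 • w := by
      conv_lhs => rw [← X_mul_divX_add f]
      rw [add_smul, mul_smul, del_apply, ← Polynomial.algebraMap_eq, algebraMap_smul]
    rw [hf']
    refine ⟨fun n hn => ?_, ?_⟩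
    · rw [map_add, hL.apply_del, ih0 n (by omega), ih0 (n - 1) (by omega), map_smul,
        hw n (by omega)]
      simp
    · rw [map_add, hL.apply_del, ih0 (M + (N + 1)) (by omega), (L _).map_smul,
        hw (M + (N + 1)) (by omega),
        show M + (N + 1) - 1 = M + N by omega, map_zero, zero_add, smul_zero, add_zero, smul_comm,
        ih1, coeff_divX, smul_smul, ← add_assoc, Nat.factorial_succ (M + N)]
      push_cast
      rfl

/-- If `f • w = 0` with `f ≠ 0`, the leading term of `f(∂ + λ) (a_λ w)` is a nonzero scalar times
the top coefficient of `a_λ w`, so no coefficient can be the last nonzero one. -/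
lemma IsCoeffFamily.apply_eq_zero_of_mem_torsion (hL : IsCoeffFamily L) {w : W}
    (hw : w ∈ Submodule.torsion ℂ[X] W) (n : ℕ) : L n w = 0 := by
  obtain ⟨⟨f, hf⟩, hfw⟩ := (Submodule.mem_torsion_iff _).mp hw
  change f • w = 0 at hfw
  obtain ⟨M, hM⟩ := hL.eventually_zero w
  -- Descending induction on the index: each step in `k` lowers the vanishing bound by one.
  suffices h : ∀ k, ∀ n, M < n + k → L n w = 0 from h (M + 1) n (by omega)
  intro k
  induction k with
  | zero => exact hM
  | succ k ih =>
    intro n hn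
    have h := (hL.apply_smul_top (M := n) f.natDegree f le_rfl
      (fun m hm => ih m (by omega))).2
    rw [hfw, map_zero, smul_zero] at h
    rcases smul_eq_zero.mp h.symm with h' | h'
    · exact absurd h' (Nat.cast_ne_zero.mpr (Nat.factorial_ne_zero _))
    · refine (smul_eq_zero.mp h').resolve_left ?_
      exact leadingCoeff_ne_zero.mpr (nonZeroDivisors.ne_zero hf)

lemma IsCoeffFamily.exists_last_ne_zero (hL : IsCoeffFamily L) {w : W} {m : ℕ} (h : L m w ≠ 0) :
    ∃ M, m ≤ M ∧ L M w ≠ 0 ∧ ∀ n, M < n → L n w = 0 := by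
  classical
  obtain ⟨K, hK⟩ := hL.eventually_zero w
  have hmK : m ≤ K := by by_contra hc; exact h (hK m (by omega))
  refine ⟨Nat.findGreatest (fun n => L n w ≠ 0) K, Nat.le_findGreatest hmK h,
    Nat.findGreatest_spec (P := fun n => L n w ≠ 0) hmK h, fun n hn => ?_⟩
  by_contra hc
  by_cases hnK : n ≤ K
  · exact Nat.findGreatest_is_greatest hn hnK hc
  · exact hc (hK n (by omega))

/-- In a finite module, the top coefficient operator satisfies a `ℂ`-linear relation along every
sequence, obtained from the leading terms of a `ℂ[∂]`-linear relation. -/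
lemma IsCoeffFamily.exists_top_relation [Module.Finite ℂ[X] W] (hL : IsCoeffFamily L)
    {M : ℕ} (w : ℕ → W) (hw : ∀ i n, M < n → L n (w i) = 0) :
    ∃ q : ℂ[X], q ≠ 0 ∧ L M (q.sum fun i a => a • w i) = 0 := by
  have hdep : ¬ LinearIndependent ℂ[X] w := fun h => by
    have := h.finite_of_isNoetherian
    exact not_finite ℕ
  rw [linearIndependent_iff'] at hdep
  push Not at hdep
  obtain ⟨s, f, hsum, i₀, hi₀, hfi₀⟩ := hdep
  -- With `N` the largest degree among the `f i`, the coefficient at index `M + N` sees only the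
  -- scalars `(f i).coeff N`, and the one at `i₁` is nonzero.
  obtain ⟨i₁, hi₁, hmax⟩ := (s.filter (fun i => f i ≠ 0)).exists_max_image
    (fun i => (f i).natDegree) ⟨i₀, by simp [hi₀, hfi₀]⟩
  rw [Finset.mem_filter] at hi₁
  set N := (f i₁).natDegree with hN
  have hle : ∀ i ∈ s, (f i).natDegree ≤ N := fun i hi => by
    by_cases h0 : f i = 0
    · simp [h0]
    · exact hmax i (by simp [hi, h0])
  have key : ∑ i ∈ s, (f i).coeff N • L M (w i) = 0 := by
    have h1 : ∑ i ∈ s, (M.factorial : ℂ) • L (M + N) (f i • w i) = 0 := by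
      rw [← Finset.smul_sum, ← map_sum, hsum, map_zero, smul_zero]
    rw [Finset.sum_congr rfl fun i hi => (hL.apply_smul_top N (f i) (hle i hi) (hw i)).2,
      ← Finset.smul_sum] at h1
    exact (smul_eq_zero.mp h1).resolve_left (Nat.cast_ne_zero.mpr (Nat.factorial_ne_zero _))
  refine ⟨∑ i ∈ s, monomial i ((f i).coeff N), fun h0 => ?_, ?_⟩
  · have := congrArg (fun p => coeff p i₁) h0
    simp only [finsetSum_coeff, coeff_monomial, coeff_zero, Finset.sum_ite_eq', hi₁.1,
      if_true] at this
    exact hi₁.2 (leadingCoeff_eq_zero.mp this)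
  · rw [← key]
    let φ : ℂ[X] →ₗ[ℂ] W := Polynomial.lsum fun i => LinearMap.toSpanSingleton ℂ W (w i)
    have hφ : ∀ q : ℂ[X], (q.sum fun i a => a • w i) = φ q := fun q => by
      simp [φ, Polynomial.lsum_apply]
    rw [hφ, map_sum, map_sum]
    refine Finset.sum_congr rfl fun i _ => ?_
    rw [← hφ, sum_monomial_index _ _ (by simp), map_smul]

/-- The operator `∂ - a_(0)`, which for a Virasoro element commutes with `∂` and with the
coefficients of the action. -/
def centralShift (L : ℕ → Module.End ℂ W) : Module.End ℂ W := del W - L 0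

lemma centralShift_comm (hL : IsCoeffFamily L) (hV : IsVirasoroFamily L) (n : ℕ) (w : W) :
    L n (centralShift L w) = centralShift L (L n w) := by
  have h := hV n 0 w
  simp only [centralShift, LinearMap.sub_apply, map_sub, hL.apply_del]
  rw [Nat.cast_zero, sub_zero, add_zero, sub_eq_iff_eq_add] at h
  rw [h]
  abel

/-- All iterates of `w` under the central shift share the degree bound `M`, and `L M` commutes with
the shift. A top relation along them is therefore a nonzero polynomial in the shift annihilating `L
M w ≠ 0`. -/
lemma exists_centralShift_eigenvector [Module.Finite ℂ[X] W] (hL : IsCoeffFamily L)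
    (hV : IsVirasoroFamily L) (hne : ∃ n w, L n w ≠ 0) :
    ∃ (c : ℂ) (u : W), u ≠ 0 ∧ centralShift L u = c • u := by
  obtain ⟨m, w, hmw⟩ := hne
  obtain ⟨M, -, hM0, hM⟩ := hL.exists_last_ne_zero hmw
  have hpow : ∀ n i, L n ((centralShift L ^ i) w) = (centralShift L ^ i) (L n w) := by
    intro n i
    induction i with
    | zero => simp
    | succ i ih => rw [pow_succ', Module.End.mul_apply, centralShift_comm hL hV, ih,
        Module.End.mul_apply]
  obtain ⟨q, hq, hrel⟩ := hL.exists_top_relation (M := M) (fun i => (centralShift L ^ i) w)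
    (fun i n hn => by rw [hpow, hM n hn, map_zero])
  have : aeval (centralShift L) q (L M w) = 0 := by
    rw [← sum_smul_pow_apply, ← hrel, Polynomial.sum_def, Polynomial.sum_def, map_sum]
    exact Finset.sum_congr rfl fun i _ => by rw [map_smul, hpow]
  obtain ⟨c, u, -, hu, huc⟩ := exists_eigenvector_of_aeval_eq_zero (centralShift L) ⊤
    (fun _ _ => trivial) hq trivial hM0 this
  exact ⟨c, u, hu, huc⟩

/-- The `c`-eigenspace of `∂ - a_(0)`, cut down to the vectors on which the action has degree at
most `M` in `λ`. -/
def boundedEigenspace (L : ℕ → Module.End ℂ W) (c : ℂ) (M : ℕ) : Submodule ℂ W where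
  carrier := {w | centralShift L w = c • w ∧ ∀ n, M < n → L n w = 0}
  add_mem' {a b} ha hb := ⟨by rw [map_add, ha.1, hb.1, smul_add],
    fun n hn => by rw [map_add, ha.2 n hn, hb.2 n hn, add_zero]⟩
  zero_mem' := ⟨by simp, by simp⟩
  smul_mem' r a ha := ⟨by rw [map_smul, ha.1, smul_comm],
    fun n hn => by rw [map_smul, ha.2 n hn, smul_zero]⟩

lemma apply_mem_boundedEigenspace (hL : IsCoeffFamily L) (hV : IsVirasoroFamily L) {c : ℂ}
    {M m : ℕ} (hm : 1 ≤ m) {w : W} (hw : w ∈ boundedEigenspace L c M) :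
    L m w ∈ boundedEigenspace L c M := by
  refine ⟨by rw [← centralShift_comm hL hV, hw.1, map_smul], fun n hn => ?_⟩
  -- For `m ≥ 1` the index `n + m - 1` is still above `M`; this fails for `m = 0`.
  have h := hV n m w
  rw [hw.2 n hn, hw.2 (n + m - 1) (by omega)] at h
  simpa using h

/-- A top relation along the iterates of `L 1` says that `L M` kills `q(L 1) w`; injectivity of `L
M` removes the outer operator. -/
lemma exists_eigenvector_in_boundedEigenspace [Module.Finite ℂ[X] W] (hL : IsCoeffFamily L)
    (hV : IsVirasoroFamily L) {c : ℂ} {M : ℕ}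
    (hinj : ∀ w ∈ boundedEigenspace L c M, L M w = 0 → w = 0)
    {w : W} (hw : w ∈ boundedEigenspace L c M) (hw0 : w ≠ 0) :
    ∃ (α : ℂ) (u : W), u ∈ boundedEigenspace L c M ∧ u ≠ 0 ∧ L 1 u = α • u := by
  have hstab : ∀ v ∈ boundedEigenspace L c M, L 1 v ∈ boundedEigenspace L c M :=
    fun v hv => apply_mem_boundedEigenspace hL hV le_rfl hv
  have hmem := fun i => pow_apply_mem (L 1) _ hstab hw i
  obtain ⟨q, hq, hrel⟩ := hL.exists_top_relation (M := M) (fun i => (L 1 ^ i) w)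
    (fun i n hn => (hmem i).2 n hn)
  refine exists_eigenvector_of_aeval_eq_zero (L 1) _ hstab hq hw hw0 ?_
  rw [← sum_smul_pow_apply]
  refine hinj _ ?_ hrel
  exact Submodule.sum_mem _ fun i _ => Submodule.smul_mem _ _ (hmem i)

/-- An eigenvector of `a_(1)` is moved by the top coefficient through infinitely many eigenvalues,
so the top coefficient has index at most one. -/
lemma le_one_of_injective [Module.Finite ℂ[X] W] (hL : IsCoeffFamily L)
    (hV : IsVirasoroFamily L) {c : ℂ} {M : ℕ} (hM : 1 ≤ M)
    (hinj : ∀ w ∈ boundedEigenspace L c M, L M w = 0 → w = 0)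
    {α : ℂ} {u : W} (hu : u ∈ boundedEigenspace L c M) (hu0 : u ≠ 0) (hα : L 1 u = α • u) :
    M = 1 := by
  by_contra hne
  have hmem : ∀ i, (L M ^ i) u ∈ boundedEigenspace L c M := pow_apply_mem (L M) _
    (fun v hv => apply_mem_boundedEigenspace hL hV hM hv) hu
  have hnz : ∀ i, (L M ^ i) u ≠ 0 := by
    intro i
    induction i with
    | zero => simpa using hu0
    | succ i ih =>
      rw [pow_succ', Module.End.mul_apply]
      exact fun h => ih (hinj _ (hmem i) h)
  -- The increment comes from `[L 1, L M] = (1 - M) L M`.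
  have heig : ∀ i : ℕ, L 1 ((L M ^ i) u) = (α + i * (1 - M)) • (L M ^ i) u := by
    intro i
    induction i with
    | zero => simpa using hα
    | succ i ih =>
      rw [pow_succ', Module.End.mul_apply]
      have h := hV 1 M ((L M ^ i) u)
      rw [ih, map_smul, sub_eq_iff_eq_add, show 1 + M - 1 = M by omega, ← add_smul] at h
      rw [h]
      congr 1
      push_cast
      ring
  have hM1 : (1 : ℂ) - M ≠ 0 := by
    rw [sub_ne_zero]
    exact fun h => hne (by exact_mod_cast h.symm)
  have hli : LinearIndependent ℂ fun i : ℕ => (L M ^ i) u :=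
    Module.End.eigenvectors_linearIndependent' (L 1) (fun i : ℕ => α + i * (1 - M))
      (fun i j hij => by simpa [hM1] using hij) _
      (fun i => ⟨Module.End.mem_eigenspace_iff.mpr (heig i), hnz i⟩)
  obtain ⟨q, hq, hrel⟩ := hL.exists_top_relation (M := M) (fun i => (L M ^ i) u)
    (fun i n hn => (hmem i).2 n hn)
  have h0 := hinj _ (Submodule.sum_mem _ fun i _ => Submodule.smul_mem _ _ (hmem i)) hrel
  rw [linearIndependent_iff'] at hli
  exact hq (Polynomial.ext fun i => by
    by_cases hi : i ∈ q.support
    · exact hli q.support q.coeff h0 i hi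
    · simpa using hi)

theorem exists_primary_vector [Module.Finite ℂ[X] W] (hL : IsCoeffFamily L)
    (hV : IsVirasoroFamily L) (hne : ∃ n w, L n w ≠ 0) :
    ∃ (u : W) (α β : ℂ), u ≠ 0 ∧ L 0 u = del W u + β • u ∧ L 1 u = α • u ∧
      ∀ n, 2 ≤ n → L n u = 0 := by
  classical
  obtain ⟨c, u₀, hu₀, hc⟩ := exists_centralShift_eigenvector hL hV hne
  have hzero : ∀ u : W, centralShift L u = c • u → L 0 u = del W u + (-c) • u := fun u hu => by
    rw [neg_smul, ← hu, centralShift, LinearMap.sub_apply]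
    abel
  -- Minimality of `M` is what makes `L M` injective: a nonzero kernel vector would lie in the
  -- bounded eigenspace for `M - 1`.
  have hex : ∃ M, ∃ u ∈ boundedEigenspace L c M, u ≠ 0 := by
    obtain ⟨M, hM⟩ := hL.eventually_zero u₀
    exact ⟨M, u₀, ⟨hc, hM⟩, hu₀⟩
  obtain ⟨u, hu, hu0⟩ := Nat.find_spec hex
  have hmin := fun k hk => Nat.find_min hex (m := k) hk
  set M := Nat.find hex
  rcases Nat.eq_zero_or_pos M with h0 | hpos
  · refine ⟨u, 0, -c, hu0, hzero u hu.1, ?_, fun n hn => hu.2 n (by omega)⟩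
    rw [zero_smul]
    exact hu.2 1 (by omega)
  · have hinj : ∀ w ∈ boundedEigenspace L c M, L M w = 0 → w = 0 := by
      intro w hw hLw
      by_contra hw0
      refine hmin (M - 1) (by omega) ⟨w, ⟨hw.1, fun n hn => ?_⟩, hw0⟩
      rcases Nat.lt_or_ge M n with h | h
      · exact hw.2 n h
      · rwa [show n = M by omega]
    obtain ⟨α, v, hv, hv0, hα⟩ := exists_eigenvector_in_boundedEigenspace hL hV hinj hu hu0
    have hM1 := le_one_of_injective hL hV hpos hinj hv hv0 hα
    exact ⟨v, α, -c, hv0, hzero v hv.1, hα, fun n hn => hv.2 n (by omega)⟩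

end CoefficientFamilies

/-! ### Divided coefficients and substitution of the variable. -/

section DividedCoefficients

variable {W U : Type*} [AddCommGroup W] [Module ℂ W] [AddCommGroup U] [Module ℂ U]

/-- The coefficient of `λ ^ n / n!`. -/
def dividedCoeff (W : Type*) [AddCommGroup W] [Module ℂ W] (n : ℕ) :
    PolynomialModule ℂ W →ₗ[ℂ] W :=
  (n.factorial : ℂ) • (Finsupp.lapply n ∘ₗ (PolynomialModule.coeffLinearEquiv ℂ ℂ).toLinearMap)

lemma dividedCoeff_apply (n : ℕ) (p : PolynomialModule ℂ W) :
    dividedCoeff W n p = (n.factorial : ℂ) • p.coeff n := rfl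

lemma factorial_smul_mem_iff {S : Type*} [SetLike S W] [SMulMemClass S ℂ W] (P : S) (n : ℕ)
    (w : W) : (n.factorial : ℂ) • w ∈ P ↔ w ∈ P :=
  ⟨fun h => by
    have h0 : (n.factorial : ℂ) ≠ 0 := Nat.cast_ne_zero.mpr (Nat.factorial_ne_zero n)
    simpa [smul_smul, inv_mul_cancel₀ h0] using SMulMemClass.smul_mem ((n.factorial : ℂ)⁻¹) h,
  fun h => SMulMemClass.smul_mem _ h⟩

lemma dividedCoeff_ext {p q : PolynomialModule ℂ W}
    (h : ∀ n, dividedCoeff W n p = dividedCoeff W n q) : p = q := by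
  refine PolynomialModule.ext (Finsupp.ext fun n => ?_)
  have h0 : (n.factorial : ℂ) ≠ 0 := Nat.cast_ne_zero.mpr (Nat.factorial_ne_zero n)
  exact smul_right_injective W h0 (h n)

lemma coeff_mulVar (p : PolynomialModule ℂ W) (n : ℕ) :
    (mulVar W p).coeff n = if n = 0 then 0 else p.coeff (n - 1) := by
  change ((X : ℂ[X]) • p).coeff n = _
  rw [← monomial_one_one_eq_X, PolynomialModule.monomial_smul_apply]
  rcases n with _ | n <;> simp

lemma dividedCoeff_mulVar (n : ℕ) (p : PolynomialModule ℂ W) :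
    dividedCoeff W n (mulVar W p) = (n : ℂ) • dividedCoeff W (n - 1) p := by
  rw [dividedCoeff_apply, dividedCoeff_apply, coeff_mulVar]
  rcases n with _ | n
  · simp
  · simp [Nat.factorial_succ, smul_smul]

lemma dividedCoeff_constPoly (n : ℕ) (w : W) :
    dividedCoeff W n (constPoly W w) = if n = 0 then w else 0 := by
  rw [dividedCoeff_apply, constPoly, PolynomialModule.lsingle_apply]
  rcases n with _ | n <;> simp

lemma dividedCoeff_map (n : ℕ) (f : W →ₗ[ℂ] U) (p : PolynomialModule ℂ W) :
    dividedCoeff U n (PolynomialModule.map ℂ f p) = f (dividedCoeff W n p) := by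
  rw [dividedCoeff_apply, dividedCoeff_apply, map_smul]
  rfl

lemma substVar_eq_lsum (T : Module.End ℂ U) (ι : W →ₗ[ℂ] U) (p : PolynomialModule ℂ W) :
    substVar T ι p = Finsupp.lsum ℂ (fun i => (T ^ i : Module.End ℂ U) ∘ₗ ι) p.coeff := rfl

lemma substVar_zero (T : Module.End ℂ U) (ι : W →ₗ[ℂ] U) : substVar T ι 0 = 0 := by
  rw [substVar_eq_lsum, PolynomialModule.coeff_zero, map_zero]

lemma substVar_add (T : Module.End ℂ U) (ι : W →ₗ[ℂ] U) (p q : PolynomialModule ℂ W) :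
    substVar T ι (p + q) = substVar T ι p + substVar T ι q := by
  simp only [substVar_eq_lsum, PolynomialModule.coeff_add, map_add]

lemma substVar_single (T : Module.End ℂ U) (ι : W →ₗ[ℂ] U) (n : ℕ) (w : W) :
    substVar T ι (PolynomialModule.single ℂ n w) = (T ^ n) (ι w) := by
  rw [substVar, PolynomialModule.coeff_single, Finsupp.sum_single_index (by simp)]

lemma map_substVar {U' : Type*} [AddCommGroup U'] [Module ℂ U'] {T : Module.End ℂ U}
    {T' : Module.End ℂ U'} (φ : U →ₗ[ℂ] U') (h : ∀ u, φ (T u) = T' (φ u)) (ι : W →ₗ[ℂ] U)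
    (p : PolynomialModule ℂ W) : φ (substVar T ι p) = substVar T' (φ ∘ₗ ι) p := by
  have hpow : ∀ i u, φ ((T ^ i) u) = (T' ^ i) (φ u) := by
    intro i u
    induction i with
    | zero => simp
    | succ i ih => rw [pow_succ', pow_succ', Module.End.mul_apply, Module.End.mul_apply, h, ih]
  rw [substVar, substVar, Finsupp.sum, Finsupp.sum, map_sum]
  exact Finset.sum_congr rfl fun i _ => hpow _ _

lemma dividedCoeff_mulVar_pow_constPoly (k n : ℕ) (w : W) :
    dividedCoeff W n ((mulVar W ^ k) (constPoly W w)) =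
      if k = n then (n.factorial : ℂ) • w else 0 := by
  induction k generalizing n with
  | zero =>
    rw [pow_zero, Module.End.one_apply, dividedCoeff_constPoly]
    rcases n with _ | n <;> simp
  | succ k ih =>
    rw [pow_succ', Module.End.mul_apply, dividedCoeff_mulVar, ih]
    rcases n with _ | n
    · simp
    · by_cases h : k = n <;> simp [h, Nat.factorial_succ, smul_smul]

lemma dividedCoeff_substVar_mulVar (n : ℕ) (g : W →ₗ[ℂ] U) (p : PolynomialModule ℂ W) :
    dividedCoeff U n (substVar (mulVar U) (constPoly U ∘ₗ g) p) = g (dividedCoeff W n p) := by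
  induction p using PolynomialModule.induction_linear with
  | zero => rw [substVar_zero, map_zero, map_zero, map_zero]
  | add p q hp hq => rw [substVar_add, map_add, map_add, map_add, hp, hq]
  | single k w =>
    rw [substVar_single, LinearMap.comp_apply, dividedCoeff_mulVar_pow_constPoly,
      dividedCoeff_apply, PolynomialModule.coeff_single, Finsupp.single_apply]
    by_cases h : k = n <;> simp [h]

end DividedCoefficients

/-! ### Divided coefficients of the terms of the Jacobi identity. -/

section Composites

variable {A V : Type*} [AddCommGroup A] [Module ℂ A] [AddCommGroup V] [Module ℂ V]

lemma dividedCoeff_mulLambda (i j : ℕ) (p : PolynomialModule ℂ (PolynomialModule ℂ V)) :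
    dividedCoeff V i (dividedCoeff _ j (mulLambda V p)) =
      (i : ℂ) • dividedCoeff V (i - 1) (dividedCoeff _ j p) := by
  rw [mulLambda, dividedCoeff_map, dividedCoeff_mulVar]

lemma dividedCoeff_mulMu (i j : ℕ) (p : PolynomialModule ℂ (PolynomialModule ℂ V)) :
    dividedCoeff V i (dividedCoeff _ j (mulMu V p)) =
      (j : ℂ) • dividedCoeff V i (dividedCoeff _ (j - 1) p) := by
  rw [mulMu, dividedCoeff_mulVar, map_smul]

lemma dividedCoeff_lamMu (act : A →ₗ[ℂ] V →ₗ[ℂ] PolynomialModule ℂ V) (a b : A) (m : V)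
    (i j : ℕ) : dividedCoeff V i (dividedCoeff _ j (lamMu act a b m)) =
      dividedCoeff V i (act a (dividedCoeff V j (act b m))) := by
  rw [lamMu, mulMu, dividedCoeff_substVar_mulVar]

lemma dividedCoeff_muLam (act : A →ₗ[ℂ] V →ₗ[ℂ] PolynomialModule ℂ V) (a b : A) (m : V)
    (i j : ℕ) : dividedCoeff V i (dividedCoeff _ j (muLam act b a m)) =
      dividedCoeff V j (act b (dividedCoeff V i (act a m))) := by
  have hι : dividedCoeff _ j ∘ₗ (PolynomialModule.map ℂ (constPoly V) ∘ₗ act b) =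
      constPoly V ∘ₗ (dividedCoeff V j ∘ₗ act b) :=
    LinearMap.ext fun v => dividedCoeff_map j (constPoly V) (act b v)
  rw [muLam, map_substVar (T := mulLambda V) (T' := mulVar V) (dividedCoeff _ j)
      (fun u => dividedCoeff_map j (mulVar V) u),
    hι, dividedCoeff_substVar_mulVar]
  rfl

lemma dividedCoeff_pow_constPoly₂ (n i j : ℕ) (v : V) :
    dividedCoeff V i (dividedCoeff _ j (((mulLambda V + mulMu V) ^ n) (constPoly₂ V v))) =
      if n = i + j then (n.factorial : ℂ) • v else 0 := by
  induction n generalizing i j with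
  | zero =>
    rw [pow_zero, Module.End.one_apply, constPoly₂, LinearMap.comp_apply, dividedCoeff_constPoly]
    rcases j with _ | j
    · rw [if_pos rfl, dividedCoeff_constPoly]
      rcases i with _ | i <;> simp
    · simp
  | succ n ih =>
    rw [pow_succ', Module.End.mul_apply, LinearMap.add_apply, map_add, map_add,
      dividedCoeff_mulLambda, dividedCoeff_mulMu, ih, ih]
    by_cases h : n + 1 = i + j
    -- Multiplication by `λ` contributes `i * n!` and multiplication by `μ` contributes `j * n!`,
    -- with sum `(n + 1)!`.
    · have h' : ((n : ℂ) + 1) = i + j := by exact_mod_cast h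
      rw [if_pos h, Nat.factorial_succ]
      push_cast
      rw [h', mul_smul, add_smul]
      congr 1
      · rcases i with _ | i
        · simp
        · rw [if_pos (by omega)]
      · rcases j with _ | j
        · simp
        · rw [if_pos (by omega)]
    · rw [if_neg h]
      rcases i with _ | i <;> rcases j with _ | j
      · simp
      · rw [if_neg (c := n = 0 + (j + 1 - 1)) (by omega)]; simp
      · rw [if_neg (c := n = i + 1 - 1 + 0) (by omega)]; simp
      · rw [if_neg (by omega), if_neg (by omega)]; simp

lemma dividedCoeff_lamAddMu (act : A →ₗ[ℂ] V →ₗ[ℂ] PolynomialModule ℂ V) (m : V) (c : A)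
    (i j : ℕ) : dividedCoeff V i (dividedCoeff _ j (lamAddMu act m c)) =
      dividedCoeff V (i + j) (act c m) := by
  change dividedCoeff V i (dividedCoeff _ j
    (substVar (mulLambda V + mulMu V) (constPoly₂ V) (act c m))) = _
  induction act c m using PolynomialModule.induction_linear with
  | zero => rw [substVar_zero, map_zero, map_zero, map_zero]
  | add p q hp hq => rw [substVar_add, map_add, map_add, map_add, hp, hq]
  | single n v =>
    rw [substVar_single, dividedCoeff_pow_constPoly₂, dividedCoeff_apply,
      PolynomialModule.coeff_single, Finsupp.single_apply]
    by_cases h : n = i + j <;> simp [h]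

end Composites

section Primary

variable {W U : Type*} [AddCommGroup W] [Module ℂ W] [Module ℂ[X] W] [IsScalarTower ℂ ℂ[X] W]
  [AddCommGroup U] [Module ℂ U]

lemma dividedCoeff_primary (α β : ℂ) (w : W) (n : ℕ) :
    dividedCoeff W n (primary α β w) =
      if n = 0 then del W w + β • w else if n = 1 then α • w else 0 := by
  rw [primary, map_add, map_add, map_smul, map_smul, dividedCoeff_mulVar, dividedCoeff_constPoly,
    dividedCoeff_constPoly, dividedCoeff_constPoly]
  rcases n with _ | _ | n <;> simp

lemma substVar_primary (T : Module.End ℂ U) (ι : W →ₗ[ℂ] U) (α β : ℂ) (w : W) :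
    substVar T ι (primary α β w) = ι (del W w) + α • T (ι w) + β • ι w := by
  have hmul : mulVar W (constPoly W w) = PolynomialModule.single ℂ 1 w := by
    change (X : ℂ[X]) • PolynomialModule.single ℂ 0 w = _
    rw [← monomial_one_one_eq_X, PolynomialModule.monomial_smul_single, one_smul]
  have hp : primary α β w = PolynomialModule.single ℂ 0 (del W w) +
      PolynomialModule.single ℂ 1 (α • w) + PolynomialModule.single ℂ 0 (β • w) := by
    rw [PolynomialModule.single_smul, PolynomialModule.single_smul, ← hmul]
    rfl
  rw [hp, substVar_add, substVar_add, substVar_single, substVar_single, substVar_single]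
  simp

end Primary

/-! ### From the conformal axioms to coefficient operators, ideals and submodules. -/

section Modules

variable {𝒜 : Type*} [AddCommGroup 𝒜] [Module ℂ 𝒜] [Module ℂ[X] 𝒜] [IsScalarTower ℂ ℂ[X] 𝒜]
  [LieConformalAlgebra 𝒜]
  {V : Type*} [AddCommGroup V] [Module ℂ V] [Module ℂ[X] V] [IsScalarTower ℂ ℂ[X] V]
  [ConformalModule 𝒜 V]

variable (V) in
/-- The operator `v ↦ a_(n) v`. -/
def coeffOperator (a : 𝒜) (n : ℕ) : Module.End ℂ V := dividedCoeff V n ∘ₗ ConformalModule.act a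

lemma act_eq_iff {a : 𝒜} {v : V} {p : PolynomialModule ℂ V} :
    ConformalModule.act a v = p ↔ ∀ n, coeffOperator V a n v = dividedCoeff V n p :=
  ⟨fun h n => congrArg (dividedCoeff V n) h, dividedCoeff_ext⟩

lemma isCoeffFamily_coeffOperator (a : 𝒜) : IsCoeffFamily (coeffOperator V a) where
  eventually_zero v := by
    refine ⟨(ConformalModule.act a v).coeff.support.sup id, fun n hn => ?_⟩
    rw [coeffOperator, LinearMap.comp_apply, dividedCoeff_apply]
    have : (ConformalModule.act a v).coeff n = 0 := by
      by_contra h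
      exact absurd (Finset.le_sup (f := id) (Finsupp.mem_support_iff.mpr h)) (not_le.mpr hn)
    rw [this, smul_zero]
  apply_del n v := by
    simp only [coeffOperator, LinearMap.comp_apply]
    rw [ConformalModule.act_del, map_add, delPoly, dividedCoeff_map, dividedCoeff_mulVar]

lemma coeffOperator_del (a : 𝒜) (n : ℕ) (v : V) :
    coeffOperator V (del 𝒜 a) n v = -((n : ℂ) • coeffOperator V a (n - 1) v) := by
  simp only [coeffOperator, LinearMap.comp_apply]
  rw [ConformalModule.del_act, map_neg, dividedCoeff_mulVar]

/-- In `((∂ + 2λ) a)_{λ+μ}` the derivative acts as `-(λ + μ)`, leaving `(λ - μ) a_{λ+μ}`, whose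
divided coefficients carry the factor `i - j`. -/
lemma isVirasoroFamily_coeffOperator {a : 𝒜}
    (ha : LieConformalAlgebra.bracket a a = primary 2 0 a) :
    IsVirasoroFamily (coeffOperator V a) := by
  intro i j v
  have h := congrArg (fun p => dividedCoeff V i (dividedCoeff _ j p))
    (ConformalModule.jacobi a a v)
  simp only [map_add, dividedCoeff_lamMu, dividedCoeff_muLam, ha, polyLamAddMu, substVar_primary,
    map_smul, dividedCoeff_mulLambda, dividedCoeff_lamAddMu, zero_smul, add_zero] at h
  have hd := coeffOperator_del a (i + j) v
  simp only [coeffOperator, LinearMap.comp_apply] at hd ⊢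
  rw [h, add_sub_cancel_right, hd]
  rcases i with _ | i
  · simp
  · rw [show i + 1 - 1 + j = i + 1 + j - 1 by omega]
    module

lemma coeffOperator_comm {a b : 𝒜} (hab : LieConformalAlgebra.bracket a b = 0) (i j : ℕ) (v : V) :
    coeffOperator V a i (coeffOperator V b j v) = coeffOperator V b j (coeffOperator V a i v) := by
  have h := congrArg (fun p => dividedCoeff V i (dividedCoeff _ j p))
    (ConformalModule.jacobi a b v)
  simp only [dividedCoeff_lamMu, dividedCoeff_muLam, hab, polyLamAddMu, substVar_zero,
    zero_add] at h
  exact h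

/-- Two ideals with trivial intersection commute. -/
lemma bracket_eq_zero_of_disjoint {I J : Submodule ℂ[X] 𝒜} (hI : IsIdeal I) (hJ : IsIdeal J)
    (hIJ : Disjoint I J) {a b : 𝒜} (ha : a ∈ I) (hb : b ∈ J) :
    LieConformalAlgebra.bracket a b = 0 := by
  have hab : ∀ n, dividedCoeff 𝒜 n (LieConformalAlgebra.bracket a b) ∈ J := hJ a b hb
  have hba : ∀ n, (LieConformalAlgebra.bracket b a).coeff n ∈ I := fun n =>
    (factorial_smul_mem_iff (I.restrictScalars ℂ) n _).mp (hI b a ha n)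
  -- The bracket lies in `J[λ]` directly. Skew-symmetry puts it in `I[λ]`, since `I[λ]` is stable
  -- under the substituted operator `-λ - ∂`.
  let P : Submodule ℂ (PolynomialModule ℂ 𝒜) :=
    ⨅ n, (I.restrictScalars ℂ).comap (dividedCoeff 𝒜 n)
  have hP : ∀ p, p ∈ P ↔ ∀ n, dividedCoeff 𝒜 n p ∈ I := fun p => by simp [P]
  have hstab : ∀ p ∈ P, (-mulVar 𝒜 - delPoly 𝒜) p ∈ P := fun p hp => by
    rw [hP] at hp ⊢
    intro n
    rw [LinearMap.sub_apply, LinearMap.neg_apply, map_sub, map_neg, dividedCoeff_mulVar, delPoly,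
      dividedCoeff_map]
    exact I.sub_mem (I.neg_mem ((I.restrictScalars ℂ).smul_mem _ (hp _))) (I.smul_mem X (hp n))
  have hmem : LieConformalAlgebra.bracket a b ∈ P := by
    rw [LieConformalAlgebra.skew a b]
    refine P.neg_mem (P.sum_mem fun i _ => pow_apply_mem _ P hstab ?_ i)
    rw [hP]
    intro n
    rw [dividedCoeff_constPoly]
    split_ifs
    · exact hba i
    · exact I.zero_mem
  refine dividedCoeff_ext fun n => ?_
  rw [map_zero]
  exact Submodule.disjoint_def.mp hIJ _ ((hP _).mp hmem n) (hab n)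

lemma smul_mem_of_del_mem {W : Type*} [AddCommGroup W] [Module ℂ W] [Module ℂ[X] W]
    [IsScalarTower ℂ ℂ[X] W] (P : Submodule ℂ W) (hP : ∀ w ∈ P, del W w ∈ P) (f : ℂ[X]) (w : W)
    (hw : w ∈ P) : f • w ∈ P := by
  induction f using Polynomial.induction_on' with
  | add p q hp hq => rw [add_smul]; exact P.add_mem hp hq
  | monomial n c =>
    rw [← C_mul_X_pow_eq_monomial, mul_smul, ← Polynomial.algebraMap_eq, algebraMap_smul]
    refine P.smul_mem c ?_
    induction n with
    | zero => simpa using hw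
    | succ n ih => rw [pow_succ', mul_smul]; exact hP _ ih

/-- It suffices to check stability of a submodule on generators of the algebra and of the
submodule. -/
lemma isConformalSubmodule_span {S : Set 𝒜} (hS : Submodule.span ℂ[X] S = ⊤) {s : Set V}
    (h : ∀ a ∈ S, ∀ v ∈ s, ∀ n, coeffOperator V a n v ∈ Submodule.span ℂ[X] s) :
    IsConformalSubmodule 𝒜 (Submodule.span ℂ[X] s) := by
  set N := Submodule.span ℂ[X] s
  have h1 : ∀ a ∈ S, ∀ v ∈ N, ∀ n, coeffOperator V a n v ∈ N := by
    intro a ha v hv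
    induction hv using Submodule.span_induction with
    | mem v hv => exact h a ha v hv
    | zero => intro n; rw [map_zero]; exact N.zero_mem
    | add v w _ _ hv hw => intro n; rw [map_add]; exact N.add_mem (hv n) (hw n)
    | smul f v _ hv =>
      -- All indices are treated at once because commuting past `∂` brings in the coefficient of
      -- index `n - 1`.
      let P : Submodule ℂ V := ⨅ n, (N.restrictScalars ℂ).comap (coeffOperator V a n)
      have hP : ∀ v, v ∈ P ↔ ∀ n, coeffOperator V a n v ∈ N := fun v => by simp [P]
      refine (hP _).mp (smul_mem_of_del_mem P (fun x hx => ?_) f v ((hP v).mpr hv))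
      rw [hP] at hx ⊢
      intro n
      rw [(isCoeffFamily_coeffOperator a).apply_del]
      exact N.add_mem (N.smul_mem X (hx n)) ((N.restrictScalars ℂ).smul_mem _ (hx _))
  intro a v hv
  have ha : a ∈ Submodule.span ℂ[X] S := hS ▸ Submodule.mem_top
  change ∀ n, coeffOperator V a n v ∈ N
  have hadd : ∀ (a b : 𝒜) n, coeffOperator V (a + b) n v =
      coeffOperator V a n v + coeffOperator V b n v := fun a b n => by simp [coeffOperator]
  have hsmul : ∀ (c : ℂ) (a : 𝒜) n, coeffOperator V (c • a) n v =
      c • coeffOperator V a n v := fun c a n => by simp [coeffOperator]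
  have hzero : ∀ n, coeffOperator V (0 : 𝒜) n v = 0 := fun n => by simp [coeffOperator]
  induction ha using Submodule.span_induction with
  | mem a ha => exact h1 a ha v hv
  | zero => intro n; rw [hzero]; exact N.zero_mem
  | add a b _ _ ha hb => intro n; rw [hadd]; exact N.add_mem (ha n) (hb n)
  | smul f a _ ha =>
    let P : Submodule ℂ 𝒜 :=
      { carrier := {a | ∀ n, coeffOperator V a n v ∈ N}
        add_mem' := fun ha hb n => by rw [hadd]; exact N.add_mem (ha n) (hb n)
        zero_mem' := fun n => by rw [hzero]; exact N.zero_mem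
        smul_mem' := fun c a ha n => by
          rw [hsmul]; exact (N.restrictScalars ℂ).smul_mem _ (ha n) }
    refine smul_mem_of_del_mem P (fun x hx n => ?_) f a ha
    rw [coeffOperator_del]
    exact N.neg_mem ((N.restrictScalars ℂ).smul_mem _ (hx _))

end Modules

/-! ### Passage to the quotient by torsion, and vanishing of a commuting family. -/

section TorsionQuotient

variable {W : Type*} [AddCommGroup W] [Module ℂ W] [Module ℂ[X] W] [IsScalarTower ℂ ℂ[X] W]
  {L : ℕ → Module.End ℂ W}

/-- The family induced on the quotient by the torsion submodule. -/
def IsCoeffFamily.torsionQuotient (hL : IsCoeffFamily L) (n : ℕ) :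
    Module.End ℂ (W ⧸ Submodule.torsion ℂ[X] W) :=
  let e := Submodule.Quotient.restrictScalarsEquiv ℂ (Submodule.torsion ℂ[X] W)
  e.toLinearMap ∘ₗ Submodule.mapQ _ _ (L n) (fun w hw => by
    rw [Submodule.mem_comap, hL.apply_eq_zero_of_mem_torsion hw]
    exact Submodule.zero_mem _) ∘ₗ e.symm.toLinearMap

lemma IsCoeffFamily.torsionQuotient_mk (hL : IsCoeffFamily L) (n : ℕ) (w : W) :
    hL.torsionQuotient n (Submodule.Quotient.mk w) = Submodule.Quotient.mk (L n w) := rfl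

lemma IsCoeffFamily.isCoeffFamily_torsionQuotient (hL : IsCoeffFamily L) :
    IsCoeffFamily hL.torsionQuotient where
  eventually_zero w := by
    obtain ⟨w, rfl⟩ := Submodule.Quotient.mk_surjective _ w
    obtain ⟨M, hM⟩ := hL.eventually_zero w
    exact ⟨M, fun n hn => by rw [hL.torsionQuotient_mk, hM n hn, Submodule.Quotient.mk_zero]⟩
  apply_del n w := by
    obtain ⟨w, rfl⟩ := Submodule.Quotient.mk_surjective _ w
    exact congrArg Submodule.Quotient.mk (hL.apply_del n w)

lemma IsCoeffFamily.isVirasoroFamily_torsionQuotient (hL : IsCoeffFamily L)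
    (hV : IsVirasoroFamily L) : IsVirasoroFamily hL.torsionQuotient := by
  intro m n w
  obtain ⟨w, rfl⟩ := Submodule.Quotient.mk_surjective _ w
  exact congrArg Submodule.Quotient.mk (hV m n w)

/-- A Virasoro element acting non-trivially acts non-trivially modulo torsion. -/
lemma IsCoeffFamily.torsionQuotient_ne_zero (hL : IsCoeffFamily L) (hV : IsVirasoroFamily L)
    (hne : ∃ n w, L n w ≠ 0) : ∃ n w, hL.torsionQuotient n w ≠ 0 := by
  by_contra! h
  obtain ⟨k, w, hkw⟩ := hne
  have htor : ∀ n, L n w ∈ Submodule.torsion ℂ[X] W := fun n =>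
    (Submodule.Quotient.mk_eq_zero _).mp (h n (Submodule.Quotient.mk w))
  -- If every `L n w` is torsion, both products in `[L (k + 1), L 0] w = (k + 1) L k w` vanish,
  -- which contradicts `L k w ≠ 0`.
  have hk := hV (k + 1) 0 w
  rw [hL.apply_eq_zero_of_mem_torsion (htor _), hL.apply_eq_zero_of_mem_torsion (htor _),
    sub_zero, show k + 1 + 0 - 1 = k by omega] at hk
  refine (smul_ne_zero ?_ hkw) hk.symm
  rw [Nat.cast_zero, sub_zero]
  exact Nat.cast_ne_zero.mpr k.succ_ne_zero

/-- A family commuting with an operator `T` kills every vector on which `T` acts as `∂ + β`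
modulo torsion. -/
lemma IsCoeffFamily.apply_eq_zero_of_comm (hL : IsCoeffFamily L) {T : Module.End ℂ W} {u : W}
    {β : ℂ} (hcomm : ∀ n, T (L n u) = L n (T u))
    (hT : T u - (del W u + β • u) ∈ Submodule.torsion ℂ[X] W) (n : ℕ) : L n u = 0 := by
  by_contra hn
  obtain ⟨M, -, hM0, hM⟩ := hL.exists_last_ne_zero hn
  -- One index above the last nonzero coefficient, `T` and `β` contribute nothing and `∂`
  -- contributes `(M + 1) L M u`.
  have h := hL.apply_eq_zero_of_mem_torsion hT (M + 1)
  rw [map_sub, ← hcomm, map_add, hL.apply_del, map_smul, hM (M + 1) (by omega)] at h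
  simp only [map_zero, smul_zero, add_zero, zero_add, zero_sub, neg_eq_zero,
    Nat.add_sub_cancel] at h
  exact smul_ne_zero (Nat.cast_ne_zero.mpr M.succ_ne_zero) hM0 h

end TorsionQuotient

lemma finrank_span_singleton_of_notMem_torsion {W : Type*} [AddCommGroup W]
    [Module ℂ[X] W] {u : W} (hu : u ∉ Submodule.torsion ℂ[X] W) :
    Module.Free ℂ[X] (Submodule.span ℂ[X] {u}) ∧
      Module.finrank ℂ[X] (Submodule.span ℂ[X] {u}) = 1 := by
  have hli : LinearIndependent ℂ[X] fun _ : Unit => u := by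
    rw [linearIndependent_iff]
    intro l hl
    rw [Finsupp.linearCombination_unique] at hl
    by_contra hl0
    have h0 : l () ≠ 0 := fun h => hl0 (Finsupp.ext fun _ => h)
    exact hu ((Submodule.mem_torsion_iff _).mpr ⟨⟨_, mem_nonZeroDivisors_of_ne_zero h0⟩, hl⟩)
  have hr : Set.range (fun _ : Unit => u) = {u} := Set.range_const
  have b := Module.Basis.span hli
  rw [hr] at b
  exact ⟨Module.Free.of_basis b, by rw [Module.finrank_eq_card_basis b, Fintype.card_unit]⟩

lemma disjoint_span_singleton_of_linearIndependent_pair {R M : Type*} [Ring R] [AddCommGroup M]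
    [Module R M] {a b : M} (h : LinearIndependent R ![a, b]) :
    Disjoint (Submodule.span R {a}) (Submodule.span R {b}) := by
  rw [Submodule.disjoint_def]
  intro x hxa hxb
  obtain ⟨r, rfl⟩ := Submodule.mem_span_singleton.mp hxa
  obtain ⟨t, ht⟩ := Submodule.mem_span_singleton.mp hxb
  have := (LinearIndependent.pair_iff.mp h r (-t) (by rw [neg_smul, ht, add_neg_cancel])).1
  rw [this, zero_smul]

end LieConformal

end

/-! ### Assembly of the two statements. -/

theorem mainTheorem4
    {H : Type*} [AddCommGroup H] [Module ℂ H] [Module ℂ[X] H] [IsScalarTower ℂ ℂ[X] H]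
    [LieConformalAlgebra H]
    (A B : H)
    (hindep : LinearIndependent ℂ[X] ![A, B])
    (hspan : Submodule.span ℂ[X] {A, B} = ⊤)
    (hA : IsIdeal (Submodule.span ℂ[X] {A}))
    (hB : IsIdeal (Submodule.span ℂ[X] {B}))
    (hVir : LieConformalAlgebra.bracket A A = primary 2 0 A)
    {V : Type*} [AddCommGroup V] [Module ℂ V] [Module ℂ[X] V] [IsScalarTower ℂ ℂ[X] V]
    [ConformalModule H V] [Module.Finite ℂ[X] V]
    (hnontriv : ∃ v : V, ConformalModule.act A v ≠ 0) :
    (∃ (u : V) (α β : ℂ), u ≠ 0 ∧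
      ConformalModule.act A u = primary α β u ∧
      ConformalModule.act B u = 0 ∧
      IsConformalSubmodule H (Submodule.span ℂ[X] {u}) ∧
      (Submodule.torsion ℂ[X] V = ⊥ →
        Module.Free ℂ[X] (Submodule.span ℂ[X] {u}) ∧
        Module.finrank ℂ[X] (Submodule.span ℂ[X] {u}) = 1)) ∧
    (∃ (u : V) (α β : ℂ), u ∉ Submodule.torsion ℂ[X] V ∧
      (∀ j : ℕ, (ConformalModule.act A u - primary α β u).coeff j ∈ Submodule.torsion ℂ[X] V) ∧
      ConformalModule.act B u = 0 ∧
      IsConformalSubmodule H (Submodule.span ℂ[X] {u} ⊔ Submodule.torsion ℂ[X] V) ∧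
      Module.Free ℂ[X] (Submodule.span ℂ[X] {u}) ∧
      Module.finrank ℂ[X] (Submodule.span ℂ[X] {u}) = 1) := by
  have hAB : LieConformalAlgebra.bracket A B = 0 :=
    bracket_eq_zero_of_disjoint hA hB (disjoint_span_singleton_of_linearIndependent_pair hindep)
      (Submodule.mem_span_singleton_self A) (Submodule.mem_span_singleton_self B)
  have hL := isCoeffFamily_coeffOperator (V := V) A
  have hV := isVirasoroFamily_coeffOperator (V := V) hVir
  have hne : ∃ n v, coeffOperator V A n v ≠ 0 := by
    by_contra! h
    obtain ⟨v, hv⟩ := hnontriv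
    exact hv (act_eq_iff.mpr fun n => by rw [h, map_zero])
  -- The congruence modulo torsion suffices here, so this serves both statements.
  have hBzero : ∀ (u : V) (β : ℂ),
      coeffOperator V A 0 u - (del V u + β • u) ∈ Submodule.torsion ℂ[X] V →
      ConformalModule.act B u = 0 := fun u β hu => act_eq_iff.mpr fun n => by
    rw [map_zero]
    exact (isCoeffFamily_coeffOperator B).apply_eq_zero_of_comm
      (fun n => coeffOperator_comm hAB 0 n u) hu n
  refine ⟨?_, ?_⟩
  · obtain ⟨u, α, β, hu0, h0, h1, h2⟩ := exists_primary_vector hL hV hne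
    have hAu : ConformalModule.act A u = primary α β u := act_eq_iff.mpr fun n => by
      rw [dividedCoeff_primary]
      rcases n with _ | _ | n
      · exact h0
      · exact h1
      · exact h2 _ (by omega)
    have hBu : ConformalModule.act B u = 0 :=
      hBzero u β (by rw [h0, sub_self]; exact Submodule.zero_mem _)
    have hmem := Submodule.mem_span_singleton_self (R := ℂ[X]) u
    refine ⟨u, α, β, hu0, hAu, hBu, isConformalSubmodule_span hspan ?_, fun htor => ?_⟩
    · rintro a (rfl | rfl) v rfl n
      · rw [act_eq_iff.mp hAu, dividedCoeff_primary]
        split_ifs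
        · exact Submodule.add_mem _ (Submodule.smul_mem _ X hmem)
            (Submodule.smul_of_tower_mem _ β hmem)
        · exact Submodule.smul_of_tower_mem _ α hmem
        · exact Submodule.zero_mem _
      · rw [act_eq_iff.mp hBu, map_zero]
        exact Submodule.zero_mem _
    · exact finrank_span_singleton_of_notMem_torsion (by rwa [htor, Submodule.mem_bot])
  -- The primary vector is found in `V / Tor V`; any lift of it works.
  · obtain ⟨w, α, β, hu0, h0, h1, h2⟩ := exists_primary_vector hL.isCoeffFamily_torsionQuotient
      (hL.isVirasoroFamily_torsionQuotient hV) (hL.torsionQuotient_ne_zero hV hne)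
    obtain ⟨u, rfl⟩ := Submodule.Quotient.mk_surjective _ w
    have hu : u ∉ Submodule.torsion ℂ[X] V := fun h =>
      hu0 ((Submodule.Quotient.mk_eq_zero _).mpr h)
    have hAu : ∀ n, coeffOperator V A n u - dividedCoeff V n (primary α β u) ∈
        Submodule.torsion ℂ[X] V := fun n => by
      rw [dividedCoeff_primary, ← Submodule.Quotient.eq, ← hL.torsionQuotient_mk]
      rcases n with _ | _ | n
      · exact h0
      · exact h1
      · exact h2 _ (by omega)
    have hBu : ConformalModule.act B u = 0 := hBzero u β (by
      have := hAu 0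
      rwa [dividedCoeff_primary, if_pos rfl] at this)
    refine ⟨u, α, β, hu, fun j => ?_, hBu, ?_, finrank_span_singleton_of_notMem_torsion hu⟩
    · refine (factorial_smul_mem_iff ((Submodule.torsion ℂ[X] V).restrictScalars ℂ) j _).mp ?_
      rw [← dividedCoeff_apply, map_sub]
      exact hAu j
    · have hN : Submodule.span ℂ[X] {u} ⊔ Submodule.torsion ℂ[X] V =
          Submodule.span ℂ[X] ({u} ∪ (Submodule.torsion ℂ[X] V : Set V)) := by
        rw [Submodule.span_union, Submodule.span_eq]
      have hmem : u ∈ Submodule.span ℂ[X] {u} ⊔ Submodule.torsion ℂ[X] V :=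
        Submodule.mem_sup_left (Submodule.mem_span_singleton_self u)
      rw [hN]
      refine isConformalSubmodule_span hspan ?_
      rw [← hN]
      rintro a ha v (rfl | hv) n
      · rcases ha with rfl | rfl
        · rw [← sub_add_cancel (coeffOperator V a n v) (dividedCoeff V n (primary α β v))]
          refine Submodule.add_mem _ (Submodule.mem_sup_right (hAu n)) ?_
          rw [dividedCoeff_primary]
          split_ifs
          · exact Submodule.add_mem _ (Submodule.smul_mem _ X hmem)
              (Submodule.smul_of_tower_mem _ β hmem)
          · exact Submodule.smul_of_tower_mem _ α hmem
          · exact Submodule.zero_mem _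
        · rw [act_eq_iff.mp hBu, map_zero]
          exact Submodule.zero_mem _
      -- Torsion generators need no case split on `a`: every element of `H` kills them.
      · rw [(isCoeffFamily_coeffOperator a).apply_eq_zero_of_mem_torsion hv]
        exact Submodule.zero_mem _
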